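/- Identify the $64$ physical qubits with the vertices of the $6$-cube $\mathbb F_2^6$. For $v\in\mathbb F_2^6$ and $J\subseteq\{1,\dots,6\}$, the subcube of type $J$ through $v$ is $v+\langle J\rangle=\{w\in\mathbb F_2^6 : w_j=v_j \text{ for all } j\notin J\}$, of dimension $|J|$. For a set $Q$ of vertices and a one-qubit unitary $U$, let $U_Q$ act as $U$ on every qubit of $Q$ and as the identity elsewhere, and let $\widetilde U_Q$ act as $U$ on the qubits of $Q$ of even Hamming weight, as $U^\dagger$ on the qubits of $Q$ of odd Hamming weight, and as the identity elsewhere. Let $RM_6(d)$ be the classical Reed-Muller code of evaluation vectors of polynomials of degree at most $d$ in $6$ variables over $\mathbb F_2$. The code space of $QRM_6(1,2)$ consists of the states fixed by $X_{\mathrm{supp}(c)}$ for all $c\in RM_6(1)$ and by $Z_{\mathrm{supp}(c)}$ for all $c\in RM_6(3)$. Its logical qubits are indexed by the $15$ subsets $I\subseteq\{1,\dots,6\}$ with $|I|=2$: the logical $X_I$ is represented by $X$ on any $4$-subcube of type $\{1,\dots,6\}\setminus I$, and the logical $Z_I$ by $Z$ on any $2$-subcube of type $I$. That is, there is an isometry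 $W$ from the space of $15$ qubits onto the code space which intertwines the Pauli operators $X$ and $Z$ of the qubit $I$ with these representatives. **Theorem.** Let $A$ be the whole $6$-cube and $T=\mathrm{diag}(1,e^{i\pi/4})$. There are exactly $15$ partitions $\{I,J,K\}$ of $\{1,\dots,6\}$ into three pairs, namely $\{12,34,56\}$, $\{12,35,46\}$, $\{12,36,45\}$, $\{13,24,56\}$, $\{13,25,46\}$, $\{13,26,45\}$, $\{14,23,56\}$, $\{14,25,36\}$, $\{14,26,35\}$, $\{15,23,46\}$, $\{15,24,36\}$, $\{15,26,34\}$, $\{16,23,45\}$, $\{16,24,35\}$, $\{16,25,34\}$ (where $ij$ stands for $\{i,j\}$). Both $\widetilde T_A$ and $T_A$ preserve the code space, and the logical action of each of them is the product of the corresponding $15$ $CCZ$ gates: for every isometry $W$ as above, $$\widetilde T_A\,W \;=\; T_A\,W \;=\; W\prod_{\{I,J,K\}} CCZ_{\{I,J,K\}},$$ the product being over the $15$ partitions of $\{1,\dots,6\}$ into three pairs. -/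

import Mathlib

noncomputable section

namespace QRMCode

/-! ### Multi-qubit operators

A register of qubits labelled by `ι` has computational basis `ι → ZMod 2`; its states are the
functions `(ι → ZMod 2) → ℂ` and its operators are the matrices indexed by `ι → ZMod 2`. -/

/-- Basis labels of a register of qubits labelled by `ι`. -/
abbrev Config (ι : Type) : Type := ι → ZMod 2

/-- Operators on one qubit. -/
abbrev Gate : Type := Matrix (ZMod 2) (ZMod 2) ℂ

/-- Operators on a register of qubits labelled by `ι`. -/
abbrev Op (ι : Type) : Type := Matrix (Config ι) (Config ι) ℂ

/-- The tensor product `⨂ i, U i` of one-qubit operators. -/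
def tensorOp {ι : Type} [Fintype ι] (U : ι → Gate) : Op ι :=
  Matrix.of fun x y => ∏ i, U i (x i) (y i)

/-- `U` on every qubit of `Q`, the identity on every other qubit. -/
def applyOn {ι : Type} [Fintype ι] [DecidableEq ι] (U : Gate) (Q : Finset ι) : Op ι :=
  tensorOp fun i => if i ∈ Q then U else 1

/-- The Pauli `X` gate. -/
def gateX : Gate := Matrix.of fun a b => if a = b then 0 else 1

/-- The Pauli `Z` gate, `diag(1, -1)`. -/
def gateZ : Gate := Matrix.diagonal fun b => if b = 0 then 1 else -1

/-- The `T` gate, `diag(1, exp(iπ/4))`. -/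
def gateT : Gate :=
  Matrix.diagonal fun b => if b = 0 then 1 else Complex.exp (Complex.I * (Real.pi / 4 : ℝ))

/-- The gate which multiplies a basis state by `-1` exactly when all the qubits of `t` are `1`;
for a set `t` of three qubits this is the `CCZ` gate on them. -/
def controlledZ {ι : Type} [Fintype ι] [DecidableEq ι] (t : Finset ι) : Op ι :=
  Matrix.diagonal fun x => if ∀ i ∈ t, x i = 1 then -1 else 1

theorem controlledZ_commute {ι : Type} [Fintype ι] [DecidableEq ι] (s t : Finset ι) :
    Commute (controlledZ s) (controlledZ t) := by
  simp only [Commute, SemiconjBy, controlledZ, Matrix.diagonal_mul_diagonal]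
  congr 1
  funext x
  exact mul_comm _ _

/-! ### The cube and Reed-Muller codes -/

/-- Vertices of the `m`-cube. Coordinates are numbered `0, …, m - 1`. -/
abbrev Vertex (m : ℕ) : Type := Fin m → ZMod 2

/-- The subcube `v + ⟨J⟩` of type `J` through the vertex `v`; its dimension is `#J`. -/
def subcube {m : ℕ} (v : Vertex m) (J : Finset (Fin m)) : Finset (Vertex m) :=
  Finset.univ.filter fun w => ∀ j, j ∉ J → w j = v j

/-- The operator `Ũ` on `Q`: `U` on the qubits of `Q` of even Hamming weight in the cube, `U†` on
the qubits of `Q` of odd Hamming weight, the identity elsewhere. -/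
def applyTildeOn {m : ℕ} (U : Gate) (Q : Finset (Vertex m)) : Op (Vertex m) :=
  tensorOp fun v => if v ∈ Q then (if Even (hammingNorm v) then U else U.conjTranspose) else 1

/-- The classical Reed-Muller code `RM_m(d)`: evaluation vectors of the polynomials of degree at
most `d` in `m` variables over `𝔽₂` (the zero code if `d < 0`). -/
def RM (m : ℕ) (d : ℤ) : Submodule (ZMod 2) (Vertex m → ZMod 2) :=
  Submodule.span (ZMod 2)
    {c | ∃ P : MvPolynomial (Fin m) (ZMod 2), (P.totalDegree : ℤ) ≤ d ∧
      c = fun v => MvPolynomial.eval v P}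

/-- The set of vertices associated with a vector in `𝔽₂^(𝔽₂^m)`. -/
def supp {m : ℕ} (c : Vertex m → ZMod 2) : Finset (Vertex m) :=
  Finset.univ.filter fun v => c v = 1

/-- The code space of `QRM_m(q, r)`: the states on `2^m` qubits which are fixed by the `X`
stabilizers, given by `RM_m(q)`, and by the `Z` stabilizers, given by `RM_m(m - r - 1)`. -/
def codespace (m q r : ℕ) : Submodule ℂ (Config (Vertex m) → ℂ) where
  carrier := {ψ |
    (∀ c ∈ RM m (q : ℤ), (applyOn gateX (supp c)).mulVec ψ = ψ) ∧
    (∀ c ∈ RM m ((m : ℤ) - (r : ℤ) - 1), (applyOn gateZ (supp c)).mulVec ψ = ψ)}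
  zero_mem' := ⟨fun _ _ => Matrix.mulVec_zero _, fun _ _ => Matrix.mulVec_zero _⟩
  add_mem' := fun ha hb =>
    ⟨fun c hc => by rw [Matrix.mulVec_add, ha.1 c hc, hb.1 c hc],
     fun c hc => by rw [Matrix.mulVec_add, ha.2 c hc, hb.2 c hc]⟩
  smul_mem' := fun a _ h =>
    ⟨fun c hc => by rw [Matrix.mulVec_smul, h.1 c hc],
     fun c hc => by rw [Matrix.mulVec_smul, h.2 c hc]⟩

/-! ### Logical qubits of `QRM_6(1, 2)` -/

/-- Logical qubits of `QRM_6(1, 2)`: the 2-element subsets of the six coordinate indices. -/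
abbrev LogicalQubit : Type := {I : Finset (Fin 6) // I.card = 2}

/-- The logical qubit `{i, j}`. -/
def lq (i j : Fin 6) (h : ({i, j} : Finset (Fin 6)).card = 2 := by decide) : LogicalQubit :=
  ⟨{i, j}, h⟩

/-- `W` is an encoding of the logical register: an isometry from the space of the logical qubits
onto the code space of `QRM_6(1, 2)`, under which the logical Pauli `X` of the qubit `I` is
represented by `X` on every 4-subcube whose type is the complement of `I`, and the logical Pauli `Z`
of the qubit `I` by `Z` on every 2-subcube of type `I`. -/
structure IsEncoding (W : Matrix (Config (Vertex 6)) (Config LogicalQubit) ℂ) : Prop where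
  isometry : W.conjTranspose * W = 1
  range_eq : LinearMap.range W.mulVecLin = codespace 6 1 2
  logicalX : ∀ (I : LogicalQubit) (v : Vertex 6),
    applyOn gateX (subcube v (I.1)ᶜ) * W = W * applyOn gateX {I}
  logicalZ : ∀ (I : LogicalQubit) (v : Vertex 6),
    applyOn gateZ (subcube v I.1) * W = W * applyOn gateZ {I}

/-- The physical operator `U` preserves the code space of `QRM_6(1, 2)` and its action there is that
of the operator `L` on the logical qubits. -/
def ActsLogicallyAs (U : Op (Vertex 6)) (L : Op LogicalQubit) : Prop :=
  (∀ ψ ∈ codespace 6 1 2, U.mulVec ψ ∈ codespace 6 1 2) ∧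
  ∀ W : Matrix (Config (Vertex 6)) (Config LogicalQubit) ℂ, IsEncoding W → U * W = W * L

/-- The triples of logical qubits which partition the set of the six coordinate indices. -/
def pairPartitions : Finset (Finset LogicalQubit) :=
  (Finset.univ.powersetCard 3).filter fun t =>
    (∀ I ∈ t, ∀ J ∈ t, I ≠ J → Disjoint I.1 J.1) ∧ ∀ i : Fin 6, ∃ I ∈ t, i ∈ I.1

/-- The product of the `CCZ` gates over all the triples of logical qubits in `S`. -/
def cczProduct (S : Finset (Finset LogicalQubit)) : Op LogicalQubit :=
  S.noncommProd controlledZ fun s _ t _ _ => controlledZ_commute s t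

end QRMCode

end

/-!
Computational basis states of the 64 qubits are functions on the cube `𝔽₂^6`, so they can be
expanded in square-free monomials. A state lies in the code space iff it is constant on the cosets
of `RM_6(1)` and supported on the dual `RM_6(2)` of `RM_6(3)` (`mem_codespace`). The logical `Z`
operators read off the quadratic coefficients of a polynomial, because the sum over a 2-subcube of
type `I` extracts the coefficient of `v_I`. Hence under any encoding the image of the basis state
`k` is supported on the coset of `RM_6(1)` through the quadratic form `∑ I, k I * v_I`
(`IsEncoding.add_quadraticForm_mem`). Conversely, the uniform superpositions over these cosets form
an encoding (`standardEncoding_isEncoding`).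

The transversal `T` multiplies a basis state `x` by `exp (iπ/4)` to the power of the weight of `x`,
so only the weight modulo 8 matters. If `x` is the sum of a set `F` of monomials of degree at most
two, then inclusion-exclusion expresses its weight as the sum, over the nonempty subsets `t` of `F`,
of `(-2)^(#t - 1) * 2^(6 - u)`, where `u` is the number of variables which occur in `t`. Since
`u ≤ 2 * #t`, the terms with `#t ≠ 3` or `u < 6` vanish modulo 8, and every other term is 4 modulo 8
(`weight_modEq_four_mul_card`). Three monomials of degree at most two involve all six variables
exactly when they are `v_I`, `v_J`, `v_K` for a partition `{I, J, K}` into pairs. Thus the phase of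
`x` is `-1` to the number of such partitions with `k I = k J = k K = 1`, which is the action of the
product of the `CCZ` gates.

For `T̃`, let `L` be the parity of the Hamming weight of a vertex. Up to a constant phase, the phase
of `T̃` at `x` is the phase of `T` at `x + L`. As `L` is linear, `x + L` lies in the same coset as
`x`, and the constant is `1` because the weight of `L` is divisible by 8.
-/

noncomputable section

namespace QRMCode

open Finset

theorem zmod_two_pow (a : ZMod 2) {n : ℕ} (hn : n ≠ 0) : a ^ n = a := by
  fin_cases a
  · exact zero_pow hn
  · exact one_pow n

theorem zmod_two_eq_zero_or_one (a : ZMod 2) : a = 0 ∨ a = 1 := by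
  fin_cases a
  · exact Or.inl rfl
  · exact Or.inr rfl

/-! ### Action of the operators on basis states -/

/-- The basis label whose qubits in `Q` are `1` and whose other qubits are `0`. -/
def indicator {ι : Type} [DecidableEq ι] (Q : Finset ι) : Config ι :=
  fun i => if i ∈ Q then 1 else 0

/-- The sign `(-1) ^ a`. -/
def sign (a : ZMod 2) : ℂ := if a = 0 then 1 else -1

theorem sign_sum {α : Type*} (s : Finset α) (f : α → ZMod 2) :
    sign (∑ i ∈ s, f i) = ∏ i ∈ s, sign (f i) := by
  classical
  induction s using Finset.induction_on with
  | empty => simp [sign]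
  | insert a s ha ih =>
    rw [sum_insert ha, prod_insert ha, ← ih]
    rcases zmod_two_eq_zero_or_one (f a) with h | h <;>
      rcases zmod_two_eq_zero_or_one (∑ i ∈ s, f i) with h' | h' <;>
      simp [sign, h, h', CharTwo.add_self_eq_zero]

theorem sign_injective : Function.Injective sign := fun a b h => by
  have h1 : (1 : ℂ) ≠ -1 := by norm_num
  rcases zmod_two_eq_zero_or_one a with rfl | rfl <;>
    rcases zmod_two_eq_zero_or_one b with rfl | rfl <;> simp_all [sign]

theorem tensorOp_diagonal {ι : Type} [Fintype ι] (d : ι → ZMod 2 → ℂ) :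
    tensorOp (fun i => Matrix.diagonal (d i)) = Matrix.diagonal fun x => ∏ i, d i (x i) := by
  ext x y
  rcases eq_or_ne x y with rfl | h
  · simp [tensorOp]
  · obtain ⟨i, hi⟩ := Function.ne_iff.1 h
    rw [Matrix.diagonal_apply_ne _ h]
    exact prod_eq_zero (mem_univ i) (Matrix.diagonal_apply_ne _ hi)

section Operators

variable {ι : Type} [Fintype ι] [DecidableEq ι]

theorem applyOn_gateZ (Q : Finset ι) :
    applyOn gateZ Q = Matrix.diagonal fun x => sign (∑ i ∈ Q, x i) := by
  have h : (fun i => if i ∈ Q then gateZ else 1) =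
      fun i => Matrix.diagonal fun b => if i ∈ Q then sign b else 1 := by
    funext i
    split_ifs
    · rfl
    · exact Matrix.diagonal_one.symm
  rw [applyOn, h, tensorOp_diagonal]
  simp [sign_sum]

theorem applyOn_gateX_apply (Q : Finset ι) (x y : Config ι) :
    applyOn gateX Q x y = if y = x + indicator Q then 1 else 0 := by
  have h : ∀ a b : ZMod 2, a = b ↔ ¬ b = a + 1 := by decide
  have h1 : ∀ i, (if i ∈ Q then gateX else 1 : Gate) (x i) (y i) =
      if y i = (x + indicator Q) i then 1 else 0 := fun i => by
    by_cases hi : i ∈ Q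
    · simp only [hi, if_true, gateX, Matrix.of_apply, h (x i), Pi.add_apply, indicator, ite_not]
    · simp [hi, indicator, Matrix.one_apply, eq_comm]
  simp only [applyOn, tensorOp, Matrix.of_apply, h1, prod_boole, mem_univ, true_imp_iff,
    funext_iff]

theorem applyOn_gateX_mulVec (Q : Finset ι) (ψ : Config ι → ℂ) (x : Config ι) :
    (applyOn gateX Q).mulVec ψ x = ψ (x + indicator Q) := by
  simp [Matrix.mulVec, dotProduct, applyOn_gateX_apply]

theorem applyOn_gateX_mul {κ : Type} (Q : Finset ι) (W : Matrix (Config ι) κ ℂ)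
    (x : Config ι) (k : κ) : (applyOn gateX Q * W) x k = W (x + indicator Q) k := by
  simp [Matrix.mul_apply, applyOn_gateX_apply]

theorem mul_applyOn_gateX {κ : Type} (Q : Finset ι) (W : Matrix κ (Config ι) ℂ)
    (x : κ) (k : Config ι) : (W * applyOn gateX Q) x k = W x (k + indicator Q) := by
  have h : ∀ j, k = j + indicator Q ↔ j = k + indicator Q := fun j => by
    have hQ : indicator Q + indicator Q = 0 := funext fun i => CharTwo.add_self_eq_zero _
    constructor <;> rintro rfl <;> rw [add_assoc, hQ, add_zero]
  simp [Matrix.mul_apply, applyOn_gateX_apply, h]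

end Operators

/-- The product of the gates multiplies a basis state by `-1` once for each set of `S` all of
whose qubits are `1`. -/
theorem cczProduct_eq_diagonal (S : Finset (Finset LogicalQubit)) :
    cczProduct S = Matrix.diagonal fun k => (-1) ^ #{t ∈ S | ∀ I ∈ t, k I = 1} := by
  induction S using Finset.induction_on with
  | empty =>
    have h : cczProduct ∅ = 1 := noncommProd_empty _ _
    simp [h]
  | insert t S ht ih =>
    have h : cczProduct (insert t S) = controlledZ t * cczProduct S :=
      noncommProd_insert_of_notMem _ _ _ _ ht
    rw [h, ih, controlledZ, Matrix.diagonal_mul_diagonal]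
    congr 1
    funext k
    rw [filter_insert]
    split_ifs
    · rw [card_insert_of_notMem fun h => ht (mem_filter.1 h).1, pow_succ']
    · rw [one_mul]

/-! ### Reed-Muller codes: monomials, subcubes and duality -/

/-- The square-free monomial `∏ i ∈ S, v i` as a function on the cube. -/
def monomialFn {m : ℕ} (S : Finset (Fin m)) : Vertex m → ZMod 2 := fun v => ∏ i ∈ S, v i

theorem monomialFn_mul {m : ℕ} (S T : Finset (Fin m)) :
    monomialFn S * monomialFn T = monomialFn (S ∪ T) := by
  funext v
  simp only [monomialFn, Pi.mul_apply]
  rw [← prod_union_inter, ← prod_sdiff (inter_subset_union : S ∩ T ⊆ S ∪ T), mul_assoc,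
    ← pow_two, zmod_two_pow _ two_ne_zero]

theorem RM_eq_span (m d : ℕ) :
    RM m d = Submodule.span (ZMod 2) (monomialFn '' {S : Finset (Fin m) | #S ≤ d}) := by
  apply le_antisymm
  · refine Submodule.span_le.2 ?_
    rintro _ ⟨P, hP, rfl⟩
    have hsum : (fun v => MvPolynomial.eval v P) =
        ∑ e ∈ P.support, P.coeff e • monomialFn e.support := by
      funext v
      rw [MvPolynomial.eval_eq, Finset.sum_apply]
      refine sum_congr rfl fun e _ => ?_
      simp only [Pi.smul_apply, smul_eq_mul, monomialFn]
      congr 1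
      exact prod_congr rfl fun i hi => zmod_two_pow _ (Finsupp.mem_support_iff.1 hi)
    rw [hsum]
    refine Submodule.sum_mem _ fun e he => Submodule.smul_mem _ _
      (Submodule.subset_span ⟨_, ?_, rfl⟩)
    have h1 : #e.support ≤ e.sum fun _ n => n := by
      rw [Finsupp.sum, card_eq_sum_ones]
      exact sum_le_sum fun i hi => Nat.one_le_iff_ne_zero.2 (Finsupp.mem_support_iff.1 hi)
    have h2 := MvPolynomial.le_totalDegree he
    exact h1.trans (h2.trans (by exact_mod_cast hP))
  · refine Submodule.span_le.2 ?_
    rintro _ ⟨S, hS, rfl⟩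
    refine Submodule.subset_span ⟨∏ i ∈ S, MvPolynomial.X i, ?_, ?_⟩
    · have h := MvPolynomial.totalDegree_finsetProd S
        (fun i => (MvPolynomial.X i : MvPolynomial (Fin m) (ZMod 2)))
      simp only [MvPolynomial.totalDegree_X, sum_const, smul_eq_mul, mul_one] at h
      exact_mod_cast h.trans hS
    · funext v
      simp [monomialFn]

theorem monomialFn_mem_RM {m d : ℕ} {S : Finset (Fin m)} (hS : #S ≤ d) :
    monomialFn S ∈ RM m d := by
  rw [RM_eq_span]
  exact Submodule.subset_span ⟨S, hS, rfl⟩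

theorem RM_mono {m d e : ℕ} (h : d ≤ e) : RM m d ≤ RM m e := by
  rw [RM_eq_span, RM_eq_span]
  exact Submodule.span_mono (Set.image_mono fun S (hS : #S ≤ d) => hS.trans h)

theorem mul_mem_RM {m d e : ℕ} {f g : Vertex m → ZMod 2} (hf : f ∈ RM m d) (hg : g ∈ RM m e) :
    f * g ∈ RM m (d + e : ℕ) := by
  suffices h : RM m d * RM m e ≤ RM m (d + e : ℕ) from h (Submodule.mul_mem_mul hf hg)
  rw [RM_eq_span, RM_eq_span, Submodule.span_mul_span, Submodule.span_le]
  rintro _ ⟨_, ⟨S, hS, rfl⟩, _, ⟨T, hT, rfl⟩, rfl⟩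
  change monomialFn S * monomialFn T ∈ _
  rw [monomialFn_mul]
  exact monomialFn_mem_RM ((card_union_le S T).trans (add_le_add hS hT))

theorem mem_subcube {m : ℕ} {v w : Vertex m} {J : Finset (Fin m)} :
    w ∈ subcube v J ↔ ∀ j, j ∉ J → w j = v j := by
  simp [subcube]

theorem subcube_univ {m : ℕ} (v : Vertex m) : subcube v univ = univ := by
  ext w
  simp [mem_subcube]

theorem subcube_eq_piFinset {m : ℕ} (v : Vertex m) (J : Finset (Fin m)) :
    subcube v J = Fintype.piFinset fun j => if j ∈ J then univ else {v j} := by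
  ext w
  rw [mem_subcube, Fintype.mem_piFinset]
  refine forall_congr' fun j => ?_
  by_cases hj : j ∈ J <;> simp [hj]

/-- The sum over a subcube factors over the coordinates; a free coordinate which does not occur in
the monomial contributes the factor `1 + 1 = 0`. -/
theorem sum_subcube_monomialFn {m : ℕ} (v : Vertex m) (J S : Finset (Fin m)) :
    ∑ w ∈ subcube v J, monomialFn S w = if J ⊆ S then ∏ i ∈ S \ J, v i else 0 := by
  have h : ∀ w : Vertex m, monomialFn S w = ∏ i, if i ∈ S then w i else 1 := fun w => by
    simp [monomialFn]
  simp only [h]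
  rw [subcube_eq_piFinset, ← prod_univ_sum (fun j => if j ∈ J then univ else {v j})
    (fun i b => if i ∈ S then b else 1)]
  split_ifs with hJS
  · rw [← prod_subset (subset_univ (S \ J))]
    · refine prod_congr rfl fun i hi => ?_
      simp [(mem_sdiff.1 hi).1, (mem_sdiff.1 hi).2]
    · intro i _ hi
      by_cases hJ : i ∈ J
      · simp only [hJ, hJS hJ, if_true]
        decide
      · have hS : i ∉ S := fun hS => hi (mem_sdiff.2 ⟨hS, hJ⟩)
        simp [hJ, hS]
  · obtain ⟨i, hJ, hS⟩ := not_subset.1 hJS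
    refine prod_eq_zero (mem_univ i) ?_
    simp only [hJ, hS, if_true, if_false]
    decide

/-- A polynomial of degree less than the dimension of a subcube sums to zero over it. -/
theorem sum_subcube_eq_zero {m d : ℕ} {f : Vertex m → ZMod 2} (hf : f ∈ RM m d)
    (v : Vertex m) {J : Finset (Fin m)} (hJ : d < #J) : ∑ w ∈ subcube v J, f w = 0 := by
  rw [RM_eq_span] at hf
  induction hf using Submodule.span_induction with
  | mem f hf =>
    obtain ⟨S, hS, rfl⟩ := hf
    rw [sum_subcube_monomialFn, if_neg]
    exact fun h => absurd (card_le_card h) (not_le.2 (lt_of_le_of_lt hS hJ))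
  | zero => simp
  | add f g _ _ hf hg => simp [sum_add_distrib, hf, hg]
  | smul a f _ hf => simp [← mul_sum, hf]

/-- The indicator function of a subcube is a product of affine functions. -/
theorem indicator_subcube_apply {m : ℕ} (v w : Vertex m) (J : Finset (Fin m)) :
    indicator (subcube v J) w = ∏ i ∈ Jᶜ, (w i + (1 + v i)) := by
  have key : ∀ a b : ZMod 2, a + (1 + b) = if a = b then 1 else 0 := by decide
  simp only [indicator, key, prod_boole, mem_compl, mem_subcube]

theorem prod_add_eq_sum_monomialFn {m : ℕ} (a : Fin m → ZMod 2) (I : Finset (Fin m)) :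
    (fun w : Vertex m => ∏ i ∈ I, (w i + a i)) =
      ∑ S ∈ I.powerset, (∏ i ∈ I \ S, a i) • monomialFn S := by
  funext w
  rw [prod_add, Finset.sum_apply]
  exact sum_congr rfl fun S _ => mul_comm _ _

theorem indicator_subcube_mem_RM {m : ℕ} (v : Vertex m) (J : Finset (Fin m)) :
    indicator (subcube v J) ∈ RM m (#Jᶜ : ℕ) := by
  rw [funext (indicator_subcube_apply v · J), prod_add_eq_sum_monomialFn (fun i => 1 + v i)]
  exact Submodule.sum_mem _ fun S hS => Submodule.smul_mem _ _
    (monomialFn_mem_RM (card_le_card (mem_powerset.1 hS)))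

/-- The leading form of the indicator function of a subcube is the monomial in the coordinates
which are constant on the subcube. -/
theorem indicator_subcube_add_monomialFn_mem_RM {m d : ℕ} (v : Vertex m) {J : Finset (Fin m)}
    (hJ : #Jᶜ ≤ d + 1) :
    indicator (subcube v J) + monomialFn Jᶜ ∈ RM m d := by
  rw [funext (indicator_subcube_apply v · J), prod_add_eq_sum_monomialFn (fun i => 1 + v i),
    ← add_sum_erase _ _ (mem_powerset_self Jᶜ), sdiff_self, bot_eq_empty, prod_empty, one_smul,
    add_right_comm, CharTwo.add_self_eq_zero, zero_add]
  refine Submodule.sum_mem _ fun S hS => Submodule.smul_mem _ _ (monomialFn_mem_RM ?_)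
  obtain ⟨hne, hS⟩ := mem_erase.1 hS
  have := card_lt_card ((mem_powerset.1 hS).ssubset_of_ne hne)
  omega

/-- Möbius inversion: the coefficient of the monomial on `S` is the sum over the subcube of type
`S` through the origin. -/
theorem eq_sum_monomialFn {m : ℕ} (f : Vertex m → ZMod 2) :
    f = ∑ S : Finset (Fin m), (∑ w ∈ subcube 0 S, f w) • monomialFn S := by
  have key : ∀ a b : ZMod 2, a + (1 + b) = if b = a then 1 else 0 := by decide
  funext v
  have h : ∀ S : Finset (Fin m), (∑ w ∈ subcube 0 S, f w) =
      ∑ w, f w * ∏ i ∈ univ \ S, (1 + w i) := fun S => by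
    have h0 : ∀ w : Vertex m, ∏ i ∈ univ \ S, (1 + w i) = indicator (subcube 0 S) w :=
      fun w => by
        rw [indicator_subcube_apply, ← compl_eq_univ_sdiff]
        simp [add_comm]
    simp only [h0, indicator, mul_boole, sum_ite_mem, univ_inter]
  simp only [Finset.sum_apply, Pi.smul_apply, smul_eq_mul, h, sum_mul]
  rw [sum_comm]
  have h2 : ∀ w : Vertex m, ∑ S : Finset (Fin m), f w * (∏ i ∈ univ \ S, (1 + w i)) *
      monomialFn S v = if w = v then f w else 0 := fun w => by
    have h3 : (∏ i, (v i + (1 + w i))) = if w = v then 1 else 0 := by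
      simp only [key, prod_boole, mem_univ, true_imp_iff, funext_iff]
    rw [prod_add, powerset_univ] at h3
    simp only [mul_assoc, ← mul_sum]
    rw [← mul_boole, ← h3]
    congr 1
    exact sum_congr rfl fun S _ => mul_comm _ _
  simp [h2]

/-- A function has degree at most `d` iff all its monomial coefficients of higher degree vanish. -/
theorem mem_RM_iff {m d : ℕ} {f : Vertex m → ZMod 2} :
    f ∈ RM m d ↔ ∀ S : Finset (Fin m), d < #S → ∑ w ∈ subcube 0 S, f w = 0 := by
  refine ⟨fun hf S hS => sum_subcube_eq_zero hf 0 hS, fun h => ?_⟩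
  rw [eq_sum_monomialFn f]
  refine Submodule.sum_mem _ fun S _ => ?_
  rcases le_or_gt #S d with hS | hS
  · exact Submodule.smul_mem _ _ (monomialFn_mem_RM hS)
  · rw [h S hS, zero_smul]
    exact Submodule.zero_mem _

/-- Duality of Reed-Muller codes: `RM_m(r)` is the orthogonal complement of `RM_m(m - r - 1)`. -/
theorem mem_RM_iff_forall_dotProduct {m r s : ℕ} (h : r + s + 1 = m) {f : Vertex m → ZMod 2} :
    f ∈ RM m r ↔ ∀ c ∈ RM m s, ∑ v, c v * f v = 0 := by
  refine ⟨fun hf c hc => ?_, fun hf => mem_RM_iff.2 fun S hS => ?_⟩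
  · have := sum_subcube_eq_zero (mul_mem_RM hc hf) 0 (J := univ) (by simp; omega)
    rwa [subcube_univ] at this
  · have hc : #Sᶜ ≤ s := by rw [card_compl, Fintype.card_fin]; omega
    have := hf _ (RM_mono hc (indicator_subcube_mem_RM 0 S))
    simpa [indicator, sum_ite_mem] using this

/-! ### The weight of a quadratic form modulo 8 -/

theorem val_prod_zmod_two {α : Type*} (s : Finset α) (f : α → ZMod 2) :
    ((∏ i ∈ s, f i).val : ℤ) = ∏ i ∈ s, ((f i).val : ℤ) := by
  classical
  have h : ∀ a b : ZMod 2, (a * b).val = a.val * b.val := by decide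
  induction s using Finset.induction_on with
  | empty => rfl
  | insert a s ha ih => rw [prod_insert ha, prod_insert ha, h, Nat.cast_mul, ih]

/-- The sign `(-1) ^ a`, written `1 - 2 * a`, turns sums into products. -/
theorem one_sub_two_mul_val_sum {α : Type*} (s : Finset α) (f : α → ZMod 2) :
    1 - 2 * ((∑ i ∈ s, f i).val : ℤ) = ∏ i ∈ s, (1 - 2 * ((f i).val : ℤ)) := by
  classical
  have h : ∀ a b : ZMod 2, 1 - 2 * ((a + b).val : ℤ) =
      (1 - 2 * (a.val : ℤ)) * (1 - 2 * (b.val : ℤ)) := by decide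
  induction s using Finset.induction_on with
  | empty => rfl
  | insert a s ha ih => rw [sum_insert ha, prod_insert ha, h, ih]

theorem weight_monomialFn {m : ℕ} (S : Finset (Fin m)) :
    ∑ v, ((monomialFn S v).val : ℤ) = 2 ^ (m - #S) := by
  have h : ∀ v : Vertex m, ((monomialFn S v).val : ℤ) =
      ∏ i, if i ∈ S then ((v i).val : ℤ) else 1 := fun v => by
    rw [monomialFn, val_prod_zmod_two, prod_ite_mem, univ_inter]
  have h1 : ∑ b : ZMod 2, (b.val : ℤ) = 1 := by decide
  have h2 : ∀ i, ∑ b : ZMod 2, (if i ∈ S then (b.val : ℤ) else 1) = if i ∈ S then 1 else 2 :=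
    fun i => by
      split_ifs
      · exact h1
      · rfl
  simp only [h]
  rw [← Fintype.piFinset_univ, ← prod_univ_sum (fun _ => univ)
    (fun i (b : ZMod 2) => if i ∈ S then (b.val : ℤ) else 1)]
  simp only [h2]
  rw [prod_ite]
  simp [filter_not, ← compl_eq_univ_sdiff, card_compl]

theorem prod_monomialFn {m : ℕ} (t : Finset (Finset (Fin m))) (v : Vertex m) :
    ∏ S ∈ t, monomialFn S v = monomialFn (t.biUnion id) v := by
  induction t using Finset.induction_on with
  | empty => rfl
  | insert S t hS ih =>
    rw [prod_insert hS, ih, biUnion_insert, ← Pi.mul_apply, monomialFn_mul, id]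

/-- Inclusion-exclusion for the weight of a sum of monomials: expand the product of the signs
`1 - 2 * x` over the monomials and sum over the cube. -/
theorem two_pow_sub_two_mul_weight {m : ℕ} (F : Finset (Finset (Fin m))) :
    2 ^ m - 2 * ∑ v, (((∑ S ∈ F, monomialFn S) v).val : ℤ) =
      ∑ t ∈ F.powerset, (-2) ^ #t * 2 ^ (m - #(t.biUnion id)) := by
  have h : (2 ^ m : ℤ) = ∑ _v : Vertex m, 1 := by simp
  rw [h, mul_sum, ← sum_sub_distrib]
  simp only [Finset.sum_apply, one_sub_two_mul_val_sum]
  simp only [sub_eq_add_neg, prod_one_add,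
    ← neg_mul, prod_mul_distrib, prod_const, ← val_prod_zmod_two, prod_monomialFn]
  rw [sum_comm]
  simp only [← mul_sum, weight_monomialFn]

/-- In six variables only the triples of monomials of degree at most two which together involve all
the variables contribute to the weight modulo 8. -/
theorem weight_modEq_four_mul_card (F : Finset (Finset (Fin 6))) (hF : ∀ S ∈ F, #S ≤ 2) :
    ∑ v, (((∑ S ∈ F, monomialFn S) v).val : ℤ) ≡
      4 * #{t ∈ F.powersetCard 3 | t.biUnion id = univ} [ZMOD 8] := by
  -- the expansion computes twice the weight, hence modulo 16; the 2-adic valuation of its terms is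
  -- `#t + (6 - u)`, where the number `u` of variables is at most `2 * #t`
  have hterm : ∀ t ∈ F.powerset, ((-2) ^ #t * 2 ^ (6 - #(t.biUnion id)) : ℤ) ≡
      (if #t = 3 ∧ t.biUnion id = univ then 8 else 0) [ZMOD 16] := fun t ht => by
    have h1 : #(t.biUnion id) ≤ #t * 2 :=
      card_biUnion_le_card_mul _ _ _ fun S hS => hF S (mem_powerset.1 ht hS)
    split_ifs with h
    · rw [h.1, h.2]
      decide
    · refine Int.modEq_zero_iff_dvd.2 ?_
      have h2 : 4 ≤ #t + (6 - #(t.biUnion id)) := by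
        by_cases h3 : #t = 3
        · have h4 : t.biUnion id ≠ univ := fun h4 => h ⟨h3, h4⟩
          have h5 := card_lt_card (ssubset_univ_iff.2 h4)
          rw [card_univ, Fintype.card_fin] at h5
          omega
        · omega
      have h3 : ((-2) ^ #t * 2 ^ (6 - #(t.biUnion id)) : ℤ) =
          (-1) ^ #t * 2 ^ (#t + (6 - #(t.biUnion id))) := by
        rw [pow_add, ← mul_assoc, ← mul_pow]
        norm_num
      rw [h3]
      exact Dvd.dvd.mul_left (pow_dvd_pow 2 h2) _
  have hsum : (∑ t ∈ F.powerset, ((-2) ^ #t * 2 ^ (6 - #(t.biUnion id)) : ℤ)) ≡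
      8 * #{t ∈ F.powersetCard 3 | t.biUnion id = univ} [ZMOD 16] := by
    refine (Int.ModEq.sum hterm).trans ?_
    rw [← sum_filter, sum_const, nsmul_eq_mul, mul_comm, ← filter_filter,
      powersetCard_eq_filter]
  rw [← two_pow_sub_two_mul_weight] at hsum
  unfold Int.ModEq at *
  omega

/-! ### The code space and the basis states of the logical register -/

theorem indicator_supp {m : ℕ} (c : Vertex m → ZMod 2) : indicator (supp c) = c := by
  funext v
  rcases zmod_two_eq_zero_or_one (c v) with h | h <;> simp [indicator, supp, h]

/-- A state lies in the code space iff it is constant on the cosets of `RM_6(1)` and supported on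
the dual `RM_6(2)` of `RM_6(3)`. -/
theorem mem_codespace {ψ : Config (Vertex 6) → ℂ} :
    ψ ∈ codespace 6 1 2 ↔
      (∀ c ∈ RM 6 (1 : ℕ), ∀ x, ψ (x + c) = ψ x) ∧ ∀ x, ψ x ≠ 0 → x ∈ RM 6 (2 : ℕ) := by
  have hX : ∀ c : Vertex 6 → ZMod 2,
      (applyOn gateX (supp c)).mulVec ψ = ψ ↔ ∀ x, ψ (x + c) = ψ x := fun c => by
    simp only [funext_iff, applyOn_gateX_mulVec, indicator_supp]
  have hZ : ∀ c : Vertex 6 → ZMod 2, (applyOn gateZ (supp c)).mulVec ψ = ψ ↔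
      ∀ x, ψ x ≠ 0 → ∑ v, c v * x v = 0 := fun c => by
    have hs : ∀ x : Config (Vertex 6), ∑ v ∈ supp c, x v = ∑ v, c v * x v := fun x => by
      conv_rhs => rw [← indicator_supp c]
      simp [indicator]
    rw [applyOn_gateZ, funext_iff]
    refine forall_congr' fun x => ?_
    rw [Matrix.mulVec_diagonal, hs]
    refine ⟨fun h hx => sign_injective ?_, fun h => ?_⟩
    · rw [mul_eq_right₀ hx] at h
      rw [h, sign, if_pos rfl]
    · by_cases hx : ψ x = 0
      · simp [hx]
      · simp [h hx, sign]
  have hd : ((6 : ℕ) : ℤ) - ((2 : ℕ) : ℤ) - 1 = ((3 : ℕ) : ℤ) := by norm_num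
  change (_ ∧ _) ↔ _
  rw [hd]
  refine and_congr (forall₂_congr fun c _ => hX c) ?_
  simp only [hZ, mem_RM_iff_forall_dotProduct (show 2 + 3 + 1 = 6 by norm_num)]
  exact ⟨fun h x hx c hc => h c hc x hx, fun h c hc x hx => h x hx c hc⟩

/-- The quadratic form `∑ I, k I * v_I`, where `v_I` is the product of the two coordinates in
`I`. -/
def quadraticForm (k : Config LogicalQubit) : Config (Vertex 6) :=
  ∑ I : LogicalQubit, k I • monomialFn I.1

theorem quadraticForm_add (k l : Config LogicalQubit) :
    quadraticForm (k + l) = quadraticForm k + quadraticForm l := by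
  simp [quadraticForm, add_smul, sum_add_distrib]

theorem quadraticForm_indicator_singleton (I : LogicalQubit) :
    quadraticForm (indicator {I}) = monomialFn I.1 := by
  simp [quadraticForm, indicator]

theorem quadraticForm_mem_RM (k : Config LogicalQubit) : quadraticForm k ∈ RM 6 (2 : ℕ) :=
  Submodule.sum_mem _ fun I _ => Submodule.smul_mem _ _ (monomialFn_mem_RM I.2.le)

theorem sum_subcube_quadraticForm (k : Config LogicalQubit) (v : Vertex 6) (I : LogicalQubit) :
    ∑ w ∈ subcube v I.1, quadraticForm k w = k I := by
  have h : ∀ J : LogicalQubit, ∑ w ∈ subcube v I.1, monomialFn J.1 w = if I = J then 1 else 0 :=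
    fun J => by
      rw [sum_subcube_monomialFn]
      by_cases hIJ : I = J
      · subst hIJ
        simp
      · rw [if_neg hIJ, if_neg]
        exact fun hs => hIJ (Subtype.ext (eq_of_subset_of_card_le hs (by rw [I.2, J.2])))
  simp only [quadraticForm, Finset.sum_apply, Pi.smul_apply, smul_eq_mul]
  rw [sum_comm]
  simp only [← mul_sum, h]
  simp

theorem sum_subcube_of_add_quadraticForm_mem {x : Config (Vertex 6)} {k : Config LogicalQubit}
    (h : x + quadraticForm k ∈ RM 6 (1 : ℕ)) (v : Vertex 6) (I : LogicalQubit) :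
    ∑ w ∈ subcube v I.1, x w = k I := by
  have h0 := sum_subcube_eq_zero h v (J := I.1) (by rw [I.2]; norm_num)
  simp only [Pi.add_apply, sum_add_distrib, sum_subcube_quadraticForm] at h0
  exact CharTwo.add_eq_zero.1 h0

/-- The coset of `RM_6(1)` carrying a basis state of the logical register is cut out of `RM_6(2)`
by the eigenvalues of the logical `Z` operators. -/
theorem add_quadraticForm_mem_iff {x : Config (Vertex 6)} {k : Config LogicalQubit} :
    x + quadraticForm k ∈ RM 6 (1 : ℕ) ↔
      x ∈ RM 6 (2 : ℕ) ∧ ∀ I : LogicalQubit, ∑ w ∈ subcube 0 I.1, x w = k I := by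
  refine ⟨fun h => ⟨?_, sum_subcube_of_add_quadraticForm_mem h 0⟩, fun ⟨hx, h⟩ => ?_⟩
  · have := Submodule.add_mem _ (RM_mono one_le_two h) (quadraticForm_mem_RM k)
    rwa [add_assoc, CharTwo.add_self_eq_zero, add_zero] at this
  · refine mem_RM_iff.2 fun S hS => ?_
    rcases eq_or_ne #S 2 with h2 | h2
    · have hk := sum_subcube_quadraticForm k 0 ⟨S, h2⟩
      have hx2 := h ⟨S, h2⟩
      simp only [Pi.add_apply, sum_add_distrib, hk, hx2, CharTwo.add_self_eq_zero]
    · exact sum_subcube_eq_zero (Submodule.add_mem _ hx (quadraticForm_mem_RM k)) 0 (by omega)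

theorem eq_of_add_quadraticForm_mem {x : Config (Vertex 6)} {k l : Config LogicalQubit}
    (hk : x + quadraticForm k ∈ RM 6 (1 : ℕ)) (hl : x + quadraticForm l ∈ RM 6 (1 : ℕ)) :
    k = l := by
  funext I
  rw [← sum_subcube_of_add_quadraticForm_mem hk 0, sum_subcube_of_add_quadraticForm_mem hl 0]

/-- Under any encoding, the image of the basis state `k` is supported on the coset of `RM_6(1)`
through the quadratic form of `k`. -/
theorem IsEncoding.add_quadraticForm_mem {W : Matrix (Config (Vertex 6)) (Config LogicalQubit) ℂ}
    (hW : IsEncoding W) {x : Config (Vertex 6)} {k : Config LogicalQubit} (h : W x k ≠ 0) :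
    x + quadraticForm k ∈ RM 6 (1 : ℕ) := by
  refine add_quadraticForm_mem_iff.2 ⟨?_, fun I => ?_⟩
  · have hcol : W.mulVecLin (Pi.single k 1) ∈ codespace 6 1 2 := by
      rw [← hW.range_eq]
      exact LinearMap.mem_range_self _ _
    refine (mem_codespace.1 hcol).2 x ?_
    simpa using h
  · have hZ := congrFun (congrFun (hW.logicalZ I 0) x) k
    rw [applyOn_gateZ, applyOn_gateZ, Matrix.diagonal_mul, Matrix.mul_diagonal, mul_comm,
      sum_singleton] at hZ
    exact sign_injective (mul_left_cancel₀ h hZ)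

/-! ### The standard encoding -/

/-- The amplitude of a uniform superposition over a coset of `RM_6(1)`. -/
def cosetAmplitude : ℝ := (√(Nat.card (RM 6 (1 : ℕ))))⁻¹

theorem cosetAmplitude_ne_zero : (cosetAmplitude : ℂ) ≠ 0 := by
  have hN : (0 : ℝ) < Nat.card (RM 6 (1 : ℕ)) := by exact_mod_cast Nat.card_pos
  exact_mod_cast (inv_pos.2 (Real.sqrt_pos.2 hN)).ne'

theorem card_mul_cosetAmplitude_sq :
    (Nat.card (RM 6 (1 : ℕ)) : ℂ) * (star (cosetAmplitude : ℂ) * cosetAmplitude) = 1 := by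
  have hN : (0 : ℝ) < Nat.card (RM 6 (1 : ℕ)) := by exact_mod_cast Nat.card_pos
  have h : (Nat.card (RM 6 (1 : ℕ)) : ℝ) * (cosetAmplitude * cosetAmplitude) = 1 := by
    rw [cosetAmplitude, ← mul_inv, Real.mul_self_sqrt hN.le, mul_inv_cancel₀ hN.ne']
  rw [Complex.star_def, Complex.conj_ofReal]
  exact_mod_cast h

open Classical in
/-- The encoding which maps the basis state `k` to the uniform superposition over the coset of
`RM_6(1)` through the quadratic form of `k`. -/
def standardEncoding : Matrix (Config (Vertex 6)) (Config LogicalQubit) ℂ :=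
  Matrix.of fun x k => if x + quadraticForm k ∈ RM 6 (1 : ℕ) then (cosetAmplitude : ℂ) else 0

theorem standardEncoding_of_mem {x : Config (Vertex 6)} {k : Config LogicalQubit}
    (h : x + quadraticForm k ∈ RM 6 (1 : ℕ)) :
    standardEncoding x k = cosetAmplitude := if_pos h

theorem standardEncoding_of_notMem {x : Config (Vertex 6)} {k : Config LogicalQubit}
    (h : x + quadraticForm k ∉ RM 6 (1 : ℕ)) : standardEncoding x k = 0 := if_neg h

theorem standardEncoding_congr {x y : Config (Vertex 6)} {k l : Config LogicalQubit}
    (h : x + quadraticForm k ∈ RM 6 (1 : ℕ) ↔ y + quadraticForm l ∈ RM 6 (1 : ℕ)) :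
    standardEncoding x k = standardEncoding y l := by
  classical
  exact if_congr h rfl rfl

theorem standardEncoding_isometry :
    standardEncoding.conjTranspose * standardEncoding = 1 := by
  classical
  ext k l
  rw [Matrix.mul_apply]
  simp only [Matrix.conjTranspose_apply]
  rcases eq_or_ne k l with rfl | hkl
  · have hcard : #{x | x + quadraticForm k ∈ RM 6 (1 : ℕ)} = Nat.card (RM 6 (1 : ℕ)) := by
      rw [← Fintype.card_subtype, ← Nat.card_eq_fintype_card]
      exact Nat.card_congr ((Equiv.addRight (quadraticForm k)).subtypeEquiv fun _ => Iff.rfl)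
    have hterm : ∀ x, star (standardEncoding x k) * standardEncoding x k =
        if x + quadraticForm k ∈ RM 6 (1 : ℕ) then
          star (cosetAmplitude : ℂ) * cosetAmplitude else 0 := fun x => by
      split_ifs with hx
      · rw [standardEncoding_of_mem hx]
      · rw [standardEncoding_of_notMem hx, mul_zero]
    rw [sum_congr rfl fun x _ => hterm x, ← sum_filter, sum_const, hcard, nsmul_eq_mul,
      card_mul_cosetAmplitude_sq, Matrix.one_apply_eq]
  · rw [Matrix.one_apply_ne hkl]
    refine sum_eq_zero fun x _ => ?_
    by_cases hx : x + quadraticForm k ∈ RM 6 (1 : ℕ)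
    · rw [standardEncoding_of_notMem (k := l)
        fun hl => hkl (eq_of_add_quadraticForm_mem hx hl), mul_zero]
    · rw [standardEncoding_of_notMem hx, star_zero, zero_mul]

theorem mulVecLin_apply_eq_sum {ι κ : Type} [Fintype κ] (M : Matrix ι κ ℂ) (φ : κ → ℂ) (x : ι) :
    M.mulVecLin φ x = ∑ k, M x k * φ k := rfl

theorem range_standardEncoding :
    LinearMap.range standardEncoding.mulVecLin = codespace 6 1 2 := by
  apply le_antisymm
  · rintro _ ⟨φ, rfl⟩
    refine mem_codespace.2 ⟨fun c hc x => ?_, fun x hx => ?_⟩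
    · rw [mulVecLin_apply_eq_sum, mulVecLin_apply_eq_sum]
      refine sum_congr rfl fun k _ => ?_
      rw [standardEncoding_congr (y := x) (l := k)]
      rw [add_right_comm]
      exact Submodule.add_mem_iff_left _ hc
    · rw [mulVecLin_apply_eq_sum] at hx
      obtain ⟨k, _, hk⟩ := exists_ne_zero_of_sum_ne_zero hx
      by_contra hx2
      refine hk ?_
      rw [standardEncoding_of_notMem fun h => hx2 (add_quadraticForm_mem_iff.1 h).1, zero_mul]
  · intro ψ hψ
    obtain ⟨hX, hZ⟩ := mem_codespace.1 hψ
    -- the amplitude of `k` is the value of `ψ` on the corresponding coset, up to normalization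
    refine ⟨fun k => (cosetAmplitude : ℂ)⁻¹ * ψ (quadraticForm k), ?_⟩
    funext x
    rw [mulVecLin_apply_eq_sum]
    by_cases hx : x ∈ RM 6 (2 : ℕ)
    · have hl : x + quadraticForm (fun I => ∑ w ∈ subcube 0 I.1, x w) ∈ RM 6 (1 : ℕ) :=
        add_quadraticForm_mem_iff.2 ⟨hx, fun _ => rfl⟩
      rw [sum_eq_single_of_mem _ (mem_univ _) fun k _ hk => ?_]
      · rw [standardEncoding_of_mem hl, mul_inv_cancel_left₀ cosetAmplitude_ne_zero, ← hX _ hl,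
          add_comm x, ← add_assoc, CharTwo.add_self_eq_zero, zero_add]
      · rw [standardEncoding_of_notMem fun h => hk (eq_of_add_quadraticForm_mem h hl), zero_mul]
    · rw [show ψ x = 0 from not_not.1 fun h => hx (hZ x h)]
      refine sum_eq_zero fun k _ => ?_
      rw [standardEncoding_of_notMem fun h => hx (add_quadraticForm_mem_iff.1 h).1, zero_mul]

theorem standardEncoding_isEncoding : IsEncoding standardEncoding where
  isometry := standardEncoding_isometry
  range_eq := range_standardEncoding
  logicalX I v := by
    ext x k
    rw [applyOn_gateX_mul, mul_applyOn_gateX]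
    apply standardEncoding_congr
    have h := indicator_subcube_add_monomialFn_mem_RM v (J := (I.1)ᶜ) (d := 1)
      (by rw [compl_compl, I.2])
    rw [compl_compl] at h
    rw [quadraticForm_add, quadraticForm_indicator_singleton, ← Submodule.add_mem_iff_left _ h]
    refine iff_of_eq (congrArg (· ∈ RM 6 (1 : ℕ)) ?_)
    calc x + indicator (subcube v (I.1)ᶜ) + quadraticForm k +
          (indicator (subcube v (I.1)ᶜ) + monomialFn I.1)
        = x + (quadraticForm k + monomialFn I.1) +
          (indicator (subcube v (I.1)ᶜ) + indicator (subcube v (I.1)ᶜ)) := by abel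
      _ = _ := by rw [CharTwo.add_self_eq_zero, add_zero]
  logicalZ I v := by
    ext x k
    rw [applyOn_gateZ, applyOn_gateZ, Matrix.diagonal_mul, Matrix.mul_diagonal, sum_singleton]
    by_cases hx : x + quadraticForm k ∈ RM 6 (1 : ℕ)
    · rw [sum_subcube_of_add_quadraticForm_mem hx, mul_comm]
    · rw [standardEncoding_of_notMem hx, mul_zero, zero_mul]

/-- A diagonal operator whose phase is constant on each coset carrying a logical basis state acts
on the logical register by these phases. -/
theorem actsLogicallyAs_diagonal {d : Config (Vertex 6) → ℂ} {l : Config LogicalQubit → ℂ}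
    (h : ∀ x k, x + quadraticForm k ∈ RM 6 (1 : ℕ) → d x = l k) :
    ActsLogicallyAs (Matrix.diagonal d) (Matrix.diagonal l) := by
  have hW : ∀ W : Matrix (Config (Vertex 6)) (Config LogicalQubit) ℂ, IsEncoding W →
      Matrix.diagonal d * W = W * Matrix.diagonal l := fun W hW => by
    ext x k
    rw [Matrix.diagonal_mul, Matrix.mul_diagonal]
    by_cases hx : W x k = 0
    · rw [hx, mul_zero, zero_mul]
    · rw [h x k (hW.add_quadraticForm_mem hx), mul_comm]
  refine ⟨fun ψ hψ => ?_, hW⟩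
  rw [← range_standardEncoding] at hψ ⊢
  obtain ⟨φ, rfl⟩ := hψ
  refine ⟨(Matrix.diagonal l).mulVec φ, ?_⟩
  simp only [Matrix.mulVecLin_apply, Matrix.mulVec_mulVec, hW _ standardEncoding_isEncoding]

/-! ### The phase of `T` and `T̃` on a logical basis state -/

/-- Three sets of at most two elements which cover six points have two elements each and are
disjoint. -/
theorem card_eq_two_and_disjoint {t : Finset (Finset (Fin 6))} (ht : #t = 3)
    (h2 : ∀ S ∈ t, #S ≤ 2) (hu : t.biUnion id = univ) {S T : Finset (Fin 6)} (hS : S ∈ t)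
    (hT : T ∈ t) (hST : S ≠ T) : #S = 2 ∧ Disjoint S T := by
  have hT' : T ∈ t.erase S := mem_erase.2 ⟨hST.symm, hT⟩
  obtain ⟨U, hU⟩ : ∃ U, (t.erase S).erase T = {U} := card_eq_one.1 (by
    rw [card_erase_of_mem hT', card_erase_of_mem hS, ht])
  have hU' : U ∈ t := mem_of_mem_erase (mem_of_mem_erase (hU ▸ mem_singleton_self U))
  have ht' : t = insert S (insert T {U}) := by rw [← hU, insert_erase hT', insert_erase hS]
  rw [ht', biUnion_insert, biUnion_insert, singleton_biUnion, id, id, id, ← union_assoc] at hu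
  have h6 : #(S ∪ T ∪ U) = 6 := by rw [hu, card_univ, Fintype.card_fin]
  have h3 := card_union_le (S ∪ T) U
  have h4 := card_union_add_card_inter S T
  have hS2 := h2 S hS
  have hT2 := h2 T hT
  have hU2 := h2 U hU'
  refine ⟨by omega, ?_⟩
  rw [disjoint_iff_inter_eq_empty, ← card_eq_zero]
  omega

/-- Triples of sets of at most two elements which cover the six indices are the partitions into
pairs. -/
theorem card_pairPartitions_filter (k : Config LogicalQubit) (F : Finset (Finset (Fin 6)))
    (h2 : ∀ S ∈ F, #S ≤ 2) (hF : ∀ I : LogicalQubit, I.1 ∈ F ↔ k I = 1) :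
    #{t ∈ pairPartitions | ∀ I ∈ t, k I = 1} =
      #{t ∈ F.powersetCard 3 | t.biUnion id = univ} := by
  refine card_bij (fun t _ => t.map (Function.Embedding.subtype _)) ?_
    (fun _ _ _ _ h => map_injective _ h) ?_
  · intro t ht
    simp only [pairPartitions, mem_filter, mem_powersetCard] at ht
    obtain ⟨⟨⟨-, h3⟩, -, hcover⟩, hk⟩ := ht
    refine mem_filter.2 ⟨mem_powersetCard.2 ⟨fun S hS => ?_, by rw [card_map, h3]⟩, ?_⟩
    · obtain ⟨I, hI, rfl⟩ := mem_map.1 hS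
      exact (hF I).2 (hk I hI)
    · refine eq_univ_iff_forall.2 fun i => ?_
      obtain ⟨I, hI, hi⟩ := hcover i
      exact mem_biUnion.2 ⟨I.1, mem_map.2 ⟨I, hI, rfl⟩, hi⟩
  · intro t ht
    obtain ⟨ht, hu⟩ := mem_filter.1 ht
    obtain ⟨htF, h3⟩ := mem_powersetCard.1 ht
    have hpair := fun S hS T hT =>
      card_eq_two_and_disjoint h3 (fun S hS => h2 S (htF hS)) hu (S := S) (T := T) hS hT
    have hcard : ∀ S ∈ t, #S = 2 := fun S hS => by
      obtain ⟨T, hT, hTS⟩ := exists_mem_ne (by omega : 1 < #t) S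
      exact (hpair S hS T hT hTS.symm).1
    have hmap := subtype_map_of_mem hcard
    refine ⟨t.subtype fun S => #S = 2, ?_, hmap⟩
    simp only [pairPartitions, mem_filter, mem_powersetCard, mem_subtype]
    refine ⟨⟨⟨subset_univ _, ?_⟩, fun I hI J hJ hIJ =>
      (hpair _ hI _ hJ (Subtype.coe_injective.ne hIJ)).2, fun i => ?_⟩,
      fun I hI => (hF I).1 (htF hI)⟩
    · rw [← card_map, hmap, h3]
    · obtain ⟨S, hS, hi⟩ := mem_biUnion.1 (eq_univ_iff_forall.1 hu i)
      exact ⟨⟨S, hcard S hS⟩, hS, hi⟩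

/-- On the coset carrying the logical basis state `k`, the weight is, modulo 8, four times the
number of partitions of the indices into three pairs on which `k` is `1`. -/
theorem weight_modEq_of_add_quadraticForm_mem {x : Config (Vertex 6)} {k : Config LogicalQubit}
    (h : x + quadraticForm k ∈ RM 6 (1 : ℕ)) :
    ∑ v, (x v).val ≡ 4 * #{t ∈ pairPartitions | ∀ I ∈ t, k I = 1} [MOD 8] := by
  obtain ⟨hx, hk⟩ := add_quadraticForm_mem_iff.1 h
  -- the monomials which occur in `x`
  let F : Finset (Finset (Fin 6)) := {S | #S ≤ 2 ∧ ∑ w ∈ subcube 0 S, x w = 1}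
  have hF2 : ∀ S ∈ F, #S ≤ 2 := fun S hS => (mem_filter.1 hS).2.1
  have hFk : ∀ I : LogicalQubit, I.1 ∈ F ↔ k I = 1 := fun I => by
    simp only [F, mem_filter, mem_univ, true_and, hk I, I.2.le]
  have hxF : x = ∑ S ∈ F, monomialFn S := by
    conv_lhs => rw [eq_sum_monomialFn x]
    rw [sum_filter]
    refine sum_congr rfl fun S _ => ?_
    rcases zmod_two_eq_zero_or_one (∑ w ∈ subcube 0 S, x w) with h0 | h1
    · simp [h0]
    · have hS : #S ≤ 2 := by
        by_contra hS
        rw [mem_RM_iff.1 hx S (by omega)] at h1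
        exact zero_ne_one h1
      simp [h1, hS]
  have hw := weight_modEq_four_mul_card F hF2
  rw [← hxF, ← card_pairPartitions_filter k F hF2 hFk] at hw
  exact (Int.natCast_modEq_iff).1 (by exact_mod_cast hw)

/-- The phase `exp (iπ/4)` of the `T` gate. -/
def phaseT : ℂ := Complex.exp (Complex.I * (Real.pi / 4 : ℝ))

theorem phaseT_pow_four : phaseT ^ 4 = -1 := by
  rw [phaseT, ← Complex.exp_nat_mul, ← Complex.exp_pi_mul_I]
  congr 1
  push_cast
  ring

theorem phaseT_mul_star : phaseT * star phaseT = 1 := by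
  rw [phaseT, Complex.star_def, ← Complex.exp_conj, ← Complex.exp_add, map_mul,
    Complex.conj_I, Complex.conj_ofReal, neg_mul, add_neg_cancel, Complex.exp_zero]

theorem phaseT_pow_weight {x : Config (Vertex 6)} {k : Config LogicalQubit}
    (h : x + quadraticForm k ∈ RM 6 (1 : ℕ)) :
    phaseT ^ ∑ v, (x v).val = (-1) ^ #{t ∈ pairPartitions | ∀ I ∈ t, k I = 1} := by
  have h8 : phaseT ^ 8 = 1 := by
    rw [show 8 = 4 * 2 from rfl, pow_mul, phaseT_pow_four]
    norm_num
  rw [pow_eq_pow_mod _ h8, weight_modEq_of_add_quadraticForm_mem h, ← pow_eq_pow_mod _ h8,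
    pow_mul, phaseT_pow_four]

theorem gateT_eq : gateT = Matrix.diagonal fun b => if b = 0 then 1 else phaseT := rfl

theorem applyOn_gateT :
    applyOn gateT (subcube 0 univ) =
      Matrix.diagonal fun x : Config (Vertex 6) => phaseT ^ ∑ v, (x v).val := by
  have h : ∀ a : ZMod 2, (if a = 0 then 1 else phaseT) = phaseT ^ a.val := fun a => by
    rcases zmod_two_eq_zero_or_one a with rfl | rfl <;> simp [ZMod.val_one]
  simp only [applyOn, subcube_univ, mem_univ, if_true, gateT_eq, tensorOp_diagonal, h,
    prod_pow_eq_pow_sum]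

/-- The parity of the Hamming weight of a vertex. -/
def parity : Config (Vertex 6) := fun v => ∑ i, v i

theorem parity_mem_RM : parity ∈ RM 6 (1 : ℕ) := by
  have h : parity = ∑ i, monomialFn {i} := by
    funext v
    simp [parity, monomialFn]
  rw [h]
  exact Submodule.sum_mem _ fun i _ => monomialFn_mem_RM (by simp)

theorem parity_eq_ite (v : Vertex 6) : parity v = if Even (hammingNorm v) then 0 else 1 := by
  have h : ∀ a : ZMod 2, a = if a ≠ 0 then 1 else 0 := by decide
  have h1 : parity v = (hammingNorm v : ZMod 2) := by
    rw [parity, sum_congr rfl fun i _ => h (v i), sum_boole]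
    rfl
  rw [h1]
  split_ifs with he
  · exact (ZMod.natCast_eq_zero_iff_even).2 he
  · exact (ZMod.natCast_eq_one_iff_odd).2 (Nat.not_even_iff_odd.1 he)

/-- On a qubit whose vertex has odd weight, `T†` is `T` with its two phases exchanged, times the
conjugate of the phase of `T`. -/
theorem applyTildeOn_gateT :
    applyTildeOn gateT (subcube 0 univ) =
      Matrix.diagonal fun x : Config (Vertex 6) =>
        phaseT ^ (∑ v, ((x + parity) v).val) * star phaseT ^ ∑ v, (parity v).val := by
  have hU : ∀ v : Vertex 6, (if Even (hammingNorm v) then gateT else gateT.conjTranspose) =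
      Matrix.diagonal fun b =>
        phaseT ^ (b + parity v).val * star phaseT ^ (parity v).val := fun v => by
    rw [parity_eq_ite]
    split_ifs
    · rw [gateT_eq]
      congr 1
      funext b
      rcases zmod_two_eq_zero_or_one b with rfl | rfl <;> simp [ZMod.val_one]
    · rw [gateT_eq, Matrix.diagonal_conjTranspose]
      congr 1
      funext b
      rcases zmod_two_eq_zero_or_one b with rfl | rfl
      · simp only [Pi.star_apply, if_true, zero_add, ZMod.val_one, pow_one, phaseT_mul_star,
          star_one]
      · simp [CharTwo.add_self_eq_zero, ZMod.val_one]
  simp only [applyTildeOn, subcube_univ, mem_univ, if_true, hU, tensorOp_diagonal,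
    prod_mul_distrib, prod_pow_eq_pow_sum, Pi.add_apply]

/-- The weight of the parity function is divisible by 8, as its quadratic form is zero. -/
theorem star_phaseT_pow_weight_parity : star phaseT ^ (∑ v, (parity v).val) = 1 := by
  have h : parity + quadraticForm 0 ∈ RM 6 (1 : ℕ) := by
    simpa [quadraticForm] using parity_mem_RM
  have h0 : #{t ∈ pairPartitions | ∀ I ∈ t, (0 : Config LogicalQubit) I = 1} = 0 := by
    refine card_eq_zero.2 (filter_eq_empty_iff.2 fun t ht hk => ?_)
    have h3 := (mem_powersetCard.1 (mem_filter.1 ht).1).2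
    obtain ⟨I, hI⟩ := card_pos.1 (by omega : 0 < #t)
    exact zero_ne_one (hk I hI)
  rw [← star_pow, phaseT_pow_weight h, h0, pow_zero, star_one]

theorem actsLogicallyAs_applyOn_gateT :
    ActsLogicallyAs (applyOn gateT (subcube 0 univ)) (cczProduct pairPartitions) := by
  rw [applyOn_gateT, cczProduct_eq_diagonal]
  exact actsLogicallyAs_diagonal fun x k h => phaseT_pow_weight h

/-- The phase of `T̃` at `x` is that of `T` at `x + parity`, and adding the linear function `parity`
does not change the coset. -/
theorem actsLogicallyAs_applyTildeOn_gateT :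
    ActsLogicallyAs (applyTildeOn gateT (subcube 0 univ)) (cczProduct pairPartitions) := by
  rw [applyTildeOn_gateT, cczProduct_eq_diagonal]
  refine actsLogicallyAs_diagonal fun x k h => ?_
  rw [star_phaseT_pow_weight_parity, mul_one]
  refine phaseT_pow_weight ?_
  rw [add_right_comm]
  exact Submodule.add_mem _ h parity_mem_RM

end QRMCode

end

theorem mainTheorem7 :
    -- there are 15 logical qubits, and they do encode the whole code space
    Fintype.card QRMCode.LogicalQubit = 15 ∧
    (∃ W, QRMCode.IsEncoding W) ∧
    -- the partitions of the coordinate indices into three pairs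
    QRMCode.pairPartitions.card = 15 ∧
    QRMCode.pairPartitions =
      { {QRMCode.lq 0 1, QRMCode.lq 2 3, QRMCode.lq 4 5},
        {QRMCode.lq 0 1, QRMCode.lq 2 4, QRMCode.lq 3 5},
        {QRMCode.lq 0 1, QRMCode.lq 2 5, QRMCode.lq 3 4},
        {QRMCode.lq 0 2, QRMCode.lq 1 3, QRMCode.lq 4 5},
        {QRMCode.lq 0 2, QRMCode.lq 1 4, QRMCode.lq 3 5},
        {QRMCode.lq 0 2, QRMCode.lq 1 5, QRMCode.lq 3 4},
        {QRMCode.lq 0 3, QRMCode.lq 1 2, QRMCode.lq 4 5},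
        {QRMCode.lq 0 3, QRMCode.lq 1 4, QRMCode.lq 2 5},
        {QRMCode.lq 0 3, QRMCode.lq 1 5, QRMCode.lq 2 4},
        {QRMCode.lq 0 4, QRMCode.lq 1 2, QRMCode.lq 3 5},
        {QRMCode.lq 0 4, QRMCode.lq 1 3, QRMCode.lq 2 5},
        {QRMCode.lq 0 4, QRMCode.lq 1 5, QRMCode.lq 2 3},
        {QRMCode.lq 0 5, QRMCode.lq 1 2, QRMCode.lq 3 4},
        {QRMCode.lq 0 5, QRMCode.lq 1 3, QRMCode.lq 2 4},
        {QRMCode.lq 0 5, QRMCode.lq 1 4, QRMCode.lq 2 3} } ∧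
    -- the logical action of `T̃` and of `T` on the 6-cube
    QRMCode.ActsLogicallyAs
      (QRMCode.applyTildeOn QRMCode.gateT (QRMCode.subcube 0 Finset.univ))
      (QRMCode.cczProduct QRMCode.pairPartitions) ∧
    QRMCode.ActsLogicallyAs
      (QRMCode.applyOn QRMCode.gateT (QRMCode.subcube 0 Finset.univ))
      (QRMCode.cczProduct QRMCode.pairPartitions) := by
  refine ⟨by decide +kernel, ⟨_, QRMCode.standardEncoding_isEncoding⟩, by decide +kernel,
    by decide +kernel, QRMCode.actsLogicallyAs_applyTildeOn_gateT,
    QRMCode.actsLogicallyAs_applyOn_gateT⟩
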